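/- Let $n,t\ge 0$ be integers and consider $n$ bosonic modes on the Fock space $\mathcal H=\ell^2(\mathbb N^n)$ with number states $|m\rangle$, ladder operators $a_i,a_i^\dagger$, and quadratures $r_i=x_i=(a_i+a_i^\dagger)/\sqrt2$, $r_{n+i}=p_i=\mathrm i(a_i^\dagger-a_i)/\sqrt2$. The moment operators of degree at most $t$ are the products $r_w=r_{i_1}\cdots r_{i_k}$ over words $w=(i_1,\dots,i_k)$ with $0\le k\le t$. A state is a positive operator $\rho$ on $\mathcal H$ of trace one; a unit vector $\psi$ is identified with $|\psi\rangle\langle\psi|$. We say that $\rho$ has moments up to degree $t$ if for every such $w$ the series $M_w(\rho)=\operatorname{Tr}[\rho\, r_w]=\sum_{m,m'}\langle m|r_w|m'\rangle\langle m'|\rho|m\rangle$ converges absolutely. A Hamiltonian of degree at most $t$ is a (possibly unbounded) self-adjoint operator $H$ on $\mathcal H$ whose domain contains all finite linear combinations of number states and which acts on them as a polynomial $\sum_w c_w r_w$ (a finite sum over words of length at most $t$, $c_w\in\mathbb C$). A mixed $G_t$ state is a Gibbs state $\rho=e^{-\beta H}/\operatorname{Tr}[e^{-\beta H}]$, with $\beta>0$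 and $e^{-\beta H}$ of trace class, of such an $H$. A pure $G_t$ state is $|\psi\rangle\langle\psi|$, where $\psi$ is a unit vector that is the unique ground state of such an $H$ with nondegenerate ground state: $H\psi=E\psi$, $E\|\varphi\|^2\le\langle\varphi,H\varphi\rangle$ for all $\varphi$ in the domain of $H$, and the eigenspace of $E$ is $\mathbb C\psi$. 1. (Determination.) If $\rho,\rho'$ are $G_t$ states (each mixed or pure) that have moments up to degree $t$, and $M_w(\rho)=M_w(\rho')$ for all words $w$ of length at most $t$, then $\rho=\rho'$. 2. (Mixed case.) Let $\rho$ be a mixed $G_t$ state that has moments up to degree $t$. Then $\rho$ is a state, its von Neumann entropy $S(\rho)=-\operatorname{Tr}[\rho\log\rho]$ is finite, and every state $\sigma$ that has moments up to degree $t$, with $M_w(\sigma)=M_w(\rho)$ for all words $w$ of length at most $t$, satisfies $S(\sigma)\le S(\rho)$, with equality only if $\sigma=\rho$. 3. (Pure case.) Let $\psi$ be the unique ground state, with energy $E$, of a Hamiltonian $H$ of degree at most $t$ with nondegenerate ground state, where $H$ acts as $\sum_w c_w r_w$, and suppose that $\psi$ has moments up to degree $t$. Then: (a) $E=\sum_w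 c_w M_w(\psi)$; (b) for every state $\sigma$ that has moments up to degree $t$, $E\le\operatorname{Re}\sum_w c_w M_w(\sigma)$, with equality only if $\sigma=|\psi\rangle\langle\psi|$. That is, the moments of $\psi$ minimize $\sum_w c_w m_w$ over all attainable moment values, and only the state $\psi$ attains them; (c) if a state $\sigma$ has moments up to degree $t$ and $M_w(\sigma)=M_w(\psi)$ for all words $w$ of length at most $t$, then $\sigma=|\psi\rangle\langle\psi|$. In particular, if $\varphi$ is a unit vector that has moments up to degree $t$, all equal to those of $\psi$, then $\varphi=u\psi$ for some $u\in\mathbb C$ with $|u|=1$. -/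

import Mathlib

noncomputable section

namespace Bosonic

/-- The Hilbert space of `n` bosonic modes in the Fock (occupation number) representation. -/
abbrev FockSpace (n : ℕ) : Type := lp (fun _ : Fin n → ℕ => ℂ) 2

/-- The number state `|m⟩ = |m₁,…,mₙ⟩`. -/
def numberState {n : ℕ} (m : Fin n → ℕ) : FockSpace n := lp.single 2 m (1 : ℂ)

/-- Finite linear combinations of number states, as coefficient families. All ladder operators,
hence all polynomials in the quadratures, map this space to itself. -/
abbrev FiniteVec (n : ℕ) : Type := (Fin n → ℕ) →₀ ℂ

/-- A finite linear combination of number states as a vector of the Fock space. -/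
def toFock (n : ℕ) : FiniteVec n →ₗ[ℂ] FockSpace n :=
  Finsupp.linearCombination ℂ (numberState (n := n))

/-- `a_i |m⟩ = √m_i |m - e_i⟩` (which is `0` when `m_i = 0`). -/
def annihilation {n : ℕ} (i : Fin n) : Module.End ℂ (FiniteVec n) :=
  Finsupp.linearCombination ℂ fun m =>
    Finsupp.single (m - Pi.single i 1) ((Real.sqrt (m i) : ℝ) : ℂ)

/-- `a_i† |m⟩ = √(m_i + 1) |m + e_i⟩`. -/
def creation {n : ℕ} (i : Fin n) : Module.End ℂ (FiniteVec n) :=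
  Finsupp.linearCombination ℂ fun m =>
    Finsupp.single (m + Pi.single i 1) ((Real.sqrt (m i + 1) : ℝ) : ℂ)

/-- The quadratures `r`: `Sum.inl i` is the position `x_i = (a_i + a_i†)/√2`, and
`Sum.inr i` is the momentum `p_i = i (a_i† - a_i)/√2`. -/
def quadrature {n : ℕ} : Fin n ⊕ Fin n → Module.End ℂ (FiniteVec n)
  | Sum.inl i => (((Real.sqrt 2 : ℝ) : ℂ)⁻¹) • (annihilation i + creation i)
  | Sum.inr i => (Complex.I * ((Real.sqrt 2 : ℝ) : ℂ)⁻¹) • (creation i - annihilation i)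

/-- The moment operator `r_{i₁} r_{i₂} ⋯ r_{i_k}` of degree `k`, for the word `[i₁, …, i_k]`. -/
def momentOp {n : ℕ} (w : List (Fin n ⊕ Fin n)) : Module.End ℂ (FiniteVec n) :=
  (w.map quadrature).prod

/-- The polynomial `∑_w c_w r_w` in the quadratures. -/
def polynomialOp {n : ℕ} (c : List (Fin n ⊕ Fin n) →₀ ℂ) : Module.End ℂ (FiniteVec n) :=
  c.sum fun w z => z • momentOp w

/-- `H` is a Hamiltonian of degree at most `t`, with `H = ∑_w c_w r_w`: a self-adjoint operator
(possibly unbounded) which acts on finite combinations of number states as this polynomial of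
degree at most `t` in the quadratures. -/
structure IsHamiltonian {n : ℕ} (t : ℕ) (c : List (Fin n ⊕ Fin n) →₀ ℂ)
    (H : FockSpace n →ₗ.[ℂ] FockSpace n) : Prop where
  degree_le : ∀ w ∈ c.support, w.length ≤ t
  selfAdjoint : IsSelfAdjoint H
  extends_polynomial : ∀ f : FiniteVec n,
    ∃ h : toFock n f ∈ H.domain, H ⟨toFock n f, h⟩ = toFock n (polynomialOp c f)

/-- A density operator: positive, of trace one. -/
structure IsDensityOperator {n : ℕ} (ρ : FockSpace n →L[ℂ] FockSpace n) : Prop where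
  isPositive : ρ.IsPositive
  trace_eq_one : HasSum (fun m : Fin n → ℕ => inner ℂ (numberState m) (ρ (numberState m))) 1

/-- The pure state `|ψ⟩⟨ψ|`. -/
def pureState {n : ℕ} (ψ : FockSpace n) : FockSpace n →L[ℂ] FockSpace n :=
  InnerProductSpace.rankOne ℂ ψ ψ

/-- The summand `⟨m| r_w |m'⟩ ⟨m'| ρ |m⟩` of the trace `Tr[ρ r_w]`, for `q = (m, m')`. -/
def momentTerm {n : ℕ} (ρ : FockSpace n →L[ℂ] FockSpace n) (w : List (Fin n ⊕ Fin n))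
    (q : (Fin n → ℕ) × (Fin n → ℕ)) : ℂ :=
  momentOp w (Finsupp.single q.2 1) q.1 * inner ℂ (numberState q.2) (ρ (numberState q.1))

/-- All moments of `ρ` of degree at most `t` exist. -/
def HasMoments {n : ℕ} (t : ℕ) (ρ : FockSpace n →L[ℂ] FockSpace n) : Prop :=
  ∀ w : List (Fin n ⊕ Fin n), w.length ≤ t → Summable (momentTerm ρ w)

/-- The moment `Tr[ρ r_{i₁} ⋯ r_{i_k}]`. -/
def moment {n : ℕ} (ρ : FockSpace n →L[ℂ] FockSpace n) (w : List (Fin n ⊕ Fin n)) : ℂ :=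
  ∑' q : (Fin n → ℕ) × (Fin n → ℕ), momentTerm ρ w q

/-- `σ` and `ρ` have the same moments up to degree `t`. -/
def SameMoments {n : ℕ} (t : ℕ) (σ ρ : FockSpace n →L[ℂ] FockSpace n) : Prop :=
  ∀ w : List (Fin n ⊕ Fin n), w.length ≤ t → moment σ w = moment ρ w

/-- `-σ log σ`, by the continuous functional calculus (with `0 log 0 = 0`). -/
def negMulLogOp {K : Type*} [NormedAddCommGroup K] [InnerProductSpace ℂ K] [CompleteSpace K]
    (σ : K →L[ℂ] K) : K →L[ℂ] K :=
  cfc Real.negMulLog σ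

/-- The von Neumann entropy `-Tr[σ log σ]`, with values in `[0, ∞]`. -/
def entropy {n : ℕ} (σ : FockSpace n →L[ℂ] FockSpace n) : ENNReal :=
  ∑' m : Fin n → ℕ, ENNReal.ofReal
    (RCLike.re (inner ℂ (numberState m) (negMulLogOp σ (numberState m))))

/-- `ρ = exp(-βH) / Tr[exp(-βH)]` with `exp(-βH)` of trace class: there is an orthonormal basis
of eigenvectors of `H` whose Boltzmann weights are summable, and `ρ` is diagonal in it with the
normalized Boltzmann weights as eigenvalues. (Hilbert bases of the Fock space are countable, of the
cardinality of the number basis, so they may be indexed by occupation numbers.) -/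
def IsGibbsState {n : ℕ} (H : FockSpace n →ₗ.[ℂ] FockSpace n) (β : ℝ)
    (ρ : FockSpace n →L[ℂ] FockSpace n) : Prop :=
  ∃ (e : HilbertBasis (Fin n → ℕ) ℂ (FockSpace n)) (E : (Fin n → ℕ) → ℝ),
    (∀ k, ∃ h : e k ∈ H.domain, H ⟨e k, h⟩ = (E k : ℂ) • e k) ∧
    Summable (fun k => Real.exp (-(β * E k))) ∧
    ∀ k, ρ (e k) = ((Real.exp (-(β * E k)) / ∑' j, Real.exp (-(β * E j)) : ℝ) : ℂ) • e k

/-- `E` is the ground state energy of `H`, and the unit vector `ψ` spans its eigenspace, i.e.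
`ψ` is the unique ground state of a nondegenerate Hamiltonian. -/
structure IsUniqueGroundState {n : ℕ} (H : FockSpace n →ₗ.[ℂ] FockSpace n) (E : ℝ)
    (ψ : FockSpace n) : Prop where
  norm_eq_one : ‖ψ‖ = 1
  eigenvector : ∃ h : ψ ∈ H.domain, H ⟨ψ, h⟩ = (E : ℂ) • ψ
  energy_le : ∀ φ : H.domain,
    E * ‖(φ : FockSpace n)‖ ^ 2 ≤ RCLike.re (inner ℂ (φ : FockSpace n) (H φ))
  nondegenerate : ∀ φ : H.domain, H φ = (E : ℂ) • (φ : FockSpace n) →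
    ∃ z : ℂ, (φ : FockSpace n) = z • ψ

/-- A mixed `G_t` state: a thermal state of a Hamiltonian of degree at most `t`. -/
def IsMixedGt {n : ℕ} (t : ℕ) (ρ : FockSpace n →L[ℂ] FockSpace n) : Prop :=
  ∃ (c : List (Fin n ⊕ Fin n) →₀ ℂ) (H : FockSpace n →ₗ.[ℂ] FockSpace n) (β : ℝ),
    IsHamiltonian t c H ∧ 0 < β ∧ IsGibbsState H β ρ

/-- A pure `G_t` state: the unique ground state of a nondegenerate Hamiltonian of degree at
most `t`. -/
def IsPureGt {n : ℕ} (t : ℕ) (ρ : FockSpace n →L[ℂ] FockSpace n) : Prop :=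
  ∃ (c : List (Fin n ⊕ Fin n) →₀ ℂ) (H : FockSpace n →ₗ.[ℂ] FockSpace n) (E : ℝ)
    (ψ : FockSpace n),
    IsHamiltonian t c H ∧ IsUniqueGroundState H E ψ ∧ ρ = pureState ψ

/-- A `G_t` state, mixed or pure. -/
def IsGt {n : ℕ} (t : ℕ) (ρ : FockSpace n →L[ℂ] FockSpace n) : Prop :=
  IsMixedGt t ρ ∨ IsPureGt t ρ

end Bosonic

end

/-! Both cases rest on variational principles. The moments up to degree `t` fix the energy `∑ c_w
M_w`, and the given state is the unique optimizer at that energy. The difficulty is that `H` is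
unbounded, finite vectors need not be a core for it, and the energy of a competitor `σ` is only a
series over number states. The bridge is `add_sum_re_inner_le_energy`: a bound `H ≥ E₀ + ∑
|u_k⟩⟨u_k|` tested on finite vectors gives `Tr[σH] ≥ E₀ + ∑ ⟨u_k, σ u_k⟩`, by positivity of finite
sections and a limit.

Pure case: Cauchy–Schwarz for the form of `H - E` makes a multiple of `(H - E)χ` an admissible `u`,
for every `χ` in the domain. A state of energy `E` therefore kills the range of `H - E`. By
self-adjointness its own range consists of eigenvectors for `E`, which nondegeneracy confines to the
line of `ψ`.

Mixed case: with weights `p_k` on the eigenbasis `e_k`, `-log p_k = β(E_k - E₀)`. Summing a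
strengthened Klein inequality over this basis gives `S(σ) + ¼ ∑ ‖σ e_k - p_k e_k‖² ≤ β(Tr[σH] - E₀)
= S(ρ)`. This yields maximality, and equality forces `σ e_k = p_k e_k`. It needs only an inequality
for the energy of `σ` (`tsum_energy_le`), but an identity for that of `ρ`
(`tsum_energy_eq_of_diagonal`).

Determination follows: two mixed states bound each other's entropy, and a pure one is the only state
with its moments. -/

namespace Bosonic

open Filter Topology

/-! ### Positive operators: traces and functional calculus -/

section Hilbert

variable {K : Type*} [NormedAddCommGroup K] [InnerProductSpace ℂ K] {ι κ : Type*}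

lemma hasSum_norm_inner_sq (b : HilbertBasis ι ℂ K) (x : K) :
    HasSum (fun i => ‖inner ℂ (b i) x‖ ^ 2) (‖x‖ ^ 2) := by
  have h : HasSum (fun i => RCLike.re (inner ℂ x (b i) * inner ℂ (b i) x))
      (RCLike.re (inner ℂ x x)) := (b.hasSum_inner_mul_inner x x).mapL RCLike.reCLM
  rw [inner_self_eq_norm_sq] at h
  refine h.congr_fun fun i => ?_
  rw [← inner_conj_symm x, RCLike.conj_mul]
  norm_cast

lemma tsum_ofReal_norm_inner_sq (b : HilbertBasis ι ℂ K) (x : K) :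
    ∑' i, ENNReal.ofReal (‖inner ℂ (b i) x‖ ^ 2) = ENNReal.ofReal (‖x‖ ^ 2) := by
  have h := hasSum_norm_inner_sq b x
  rw [← ENNReal.ofReal_tsum_of_nonneg (fun i => sq_nonneg _) h.summable, h.tsum_eq]

variable [CompleteSpace K]

/-- The square root turns `⟨x, Tx⟩` into `‖Sx‖²`, so that Parseval and Tonelli apply to traces. -/
lemma exists_selfAdjoint_sqrt {T : K →L[ℂ] K} (hT : T.IsPositive) :
    ∃ S : K →L[ℂ] K, (∀ x y, inner ℂ (S x) y = inner ℂ x (S y)) ∧ S * S = T ∧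
      ∀ x y, inner ℂ x (T y) = inner ℂ (S x) (S y) := by
  have h0 : 0 ≤ T := (ContinuousLinearMap.nonneg_iff_isPositive T).2 hT
  have hS : (CFC.sqrt T).IsPositive :=
    (ContinuousLinearMap.nonneg_iff_isPositive _).1 (CFC.sqrt_nonneg T)
  have hm : CFC.sqrt T * CFC.sqrt T = T := CFC.sqrt_mul_sqrt_self T h0
  refine ⟨CFC.sqrt T, hS.inner_left_eq_inner_right, hm, fun x y => ?_⟩
  rw [hS.inner_left_eq_inner_right]
  conv_lhs => rw [← hm]
  rfl

lemma apply_eq_zero_of_re_inner_eq_zero {T : K →L[ℂ] K} (hT : T.IsPositive) {x : K}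
    (hx : RCLike.re (inner ℂ x (T x)) ≤ 0) : T x = 0 := by
  obtain ⟨S, -, hm, hS⟩ := exists_selfAdjoint_sqrt hT
  rw [hS, inner_self_eq_norm_sq] at hx
  have : S x = 0 := by
    rw [← norm_eq_zero]
    nlinarith [norm_nonneg (S x)]
  rw [← hm, mul_apply_eq_comp, this, map_zero]

/-- The trace of a positive operator does not depend on the Hilbert basis. -/
lemma tsum_ofReal_re_inner_eq (b : HilbertBasis ι ℂ K) (b' : HilbertBasis κ ℂ K)
    {T : K →L[ℂ] K} (hT : T.IsPositive) :
    ∑' i, ENNReal.ofReal (RCLike.re (inner ℂ (b i) (T (b i)))) =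
      ∑' k, ENNReal.ofReal (RCLike.re (inner ℂ (b' k) (T (b' k)))) := by
  obtain ⟨S, hS, -, hT'⟩ := exists_selfAdjoint_sqrt hT
  simp only [hT', inner_self_eq_norm_sq]
  simp_rw [← tsum_ofReal_norm_inner_sq b' (S (b _))]
  rw [ENNReal.tsum_comm]
  refine tsum_congr fun k => ?_
  rw [← tsum_ofReal_norm_inner_sq b (S (b' k))]
  refine tsum_congr fun i => ?_
  rw [← hS, norm_inner_symm]

/-- A positive operator is bounded by its trace. -/
lemma norm_le_one_of_tsum_eq_one (b : HilbertBasis ι ℂ K) {T : K →L[ℂ] K} (hT : T.IsPositive)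
    (h1 : ∑' i, ENNReal.ofReal (RCLike.re (inner ℂ (b i) (T (b i)))) = 1) : ‖T‖ ≤ 1 := by
  obtain ⟨S, hS, hm, hT'⟩ := exists_selfAdjoint_sqrt hT
  have hSn : ‖S‖ ≤ 1 := by
    refine S.opNorm_le_bound zero_le_one fun x => ?_
    rw [one_mul]
    refine le_of_sq_le_sq ?_ (norm_nonneg _)
    rw [← ENNReal.ofReal_le_ofReal_iff (sq_nonneg _), ← tsum_ofReal_norm_inner_sq b (S x)]
    calc ∑' i, ENNReal.ofReal (‖inner ℂ (b i) (S x)‖ ^ 2)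
        ≤ ∑' i, ENNReal.ofReal (RCLike.re (inner ℂ (b i) (T (b i)))) *
            ENNReal.ofReal (‖x‖ ^ 2) := by
          refine ENNReal.tsum_le_tsum fun i => ?_
          rw [hT', inner_self_eq_norm_sq, ← ENNReal.ofReal_mul (sq_nonneg _), ← mul_pow, ← hS]
          exact ENNReal.ofReal_le_ofReal
            (pow_le_pow_left₀ (norm_nonneg _) (norm_inner_le_norm _ _) 2)
      _ = ENNReal.ofReal (‖x‖ ^ 2) := by rw [ENNReal.tsum_mul_right, h1, one_mul]
  calc ‖T‖ = ‖S * S‖ := by rw [hm]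
    _ ≤ ‖S‖ * ‖S‖ := norm_mul_le _ _
    _ ≤ 1 := mul_le_one₀ hSn (norm_nonneg _) hSn

/-- The finite sections of `Tr[σ L]` are nonnegative for positive `σ` and positive
semidefinite `L`. -/
lemma re_sum_mul_inner_nonneg (b : HilbertBasis ι ℂ K) {σ : K →L[ℂ] K} (hσ : σ.IsPositive)
    (F : Finset ι) (L : ι → ι → ℂ)
    (hL : ∀ f : ι → ℂ,
      0 ≤ (∑ m ∈ F, ∑ m' ∈ F, (starRingEnd ℂ) (f m) * f m' * L m m').re) :
    0 ≤ (∑ m ∈ F, ∑ m' ∈ F, L m m' * inner ℂ (b m') (σ (b m))).re := by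
  obtain ⟨S, -, -, hS⟩ := exists_selfAdjoint_sqrt hσ
  -- Inserting the basis between the two factors `S` writes the sum as a series over `j`, whose term
  -- is the form of `L` at `f m = ⟨S b_m, b_j⟩`.
  have h : HasSum (fun j => ∑ m ∈ F, ∑ m' ∈ F,
      (starRingEnd ℂ) (inner ℂ (S (b m)) (b j)) * inner ℂ (S (b m')) (b j) * L m m')
      (∑ m ∈ F, ∑ m' ∈ F, L m m' * inner ℂ (b m') (σ (b m))) := by
    refine hasSum_sum fun m _ => hasSum_sum fun m' _ => ?_
    rw [hS]
    refine ((b.hasSum_inner_mul_inner (S (b m')) (S (b m))).mul_left (L m m')).congr_fun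
      fun j => ?_
    rw [inner_conj_symm]
    ring
  exact (h.mapL RCLike.reCLM).nonneg fun j => hL _

lemma mem_Icc_of_mem_spectrum {T : K →L[ℂ] K} (hT : T.IsPositive) (hT1 : ‖T‖ ≤ 1) {y : ℝ}
    (hy : y ∈ spectrum ℝ T) : 0 ≤ y ∧ y ≤ 1 := by
  refine ⟨spectrum_nonneg_of_nonneg ((ContinuousLinearMap.nonneg_iff_isPositive T).2 hT) hy, ?_⟩
  have h := spectrum.norm_le_norm_mul_of_mem hy
  have h1 : ‖(1 : K →L[ℂ] K)‖ ≤ 1 := ContinuousLinearMap.norm_id_le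
  have h2 := le_abs_self y
  rw [Real.norm_eq_abs] at h
  nlinarith [norm_nonneg T]

lemma isPositive_cfc {T : K →L[ℂ] K} (hT : T.IsPositive) (hT1 : ‖T‖ ≤ 1) {f : ℝ → ℝ}
    (hf : ∀ x, 0 ≤ x → x ≤ 1 → 0 ≤ f x) : (cfc f T).IsPositive := by
  refine (ContinuousLinearMap.nonneg_iff_isPositive _).1 (cfc_nonneg fun y hy => ?_)
  have := mem_Icc_of_mem_spectrum hT hT1 hy
  exact hf y this.1 this.2

lemma re_inner_cfc_le {T : K →L[ℂ] K} (hT : T.IsPositive) (hT1 : ‖T‖ ≤ 1) {f g : ℝ → ℝ}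
    (hf : Continuous f) (hg : Continuous g) (hfg : ∀ x, 0 ≤ x → x ≤ 1 → f x ≤ g x) (x : K) :
    RCLike.re (inner ℂ x (cfc f T x)) ≤ RCLike.re (inner ℂ x (cfc g T x)) := by
  have h : cfc f T ≤ cfc g T := by
    refine cfc_mono (fun y hy => ?_) hf.continuousOn hg.continuousOn
    have := mem_Icc_of_mem_spectrum hT hT1 hy
    exact hfg y this.1 this.2
  have := (ContinuousLinearMap.le_def _ _).1 h |>.re_inner_nonneg_right x
  rw [sub_apply, inner_sub_right, map_sub] at this
  linarith

/-- For quadratics the expectation involves only `‖Tx‖²`, `⟨x, Tx⟩` and `‖x‖²`. Quadratic bounds on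
a scalar function thus become usable at any vector without diagonalizing `T`. -/
lemma re_inner_cfc_quadratic {T : K →L[ℂ] K} (hT : T.IsPositive) (a b c : ℝ) (x : K) :
    RCLike.re (inner ℂ x (cfc (fun y : ℝ => a * y ^ 2 + b * y + c) T x)) =
      a * ‖T x‖ ^ 2 + b * RCLike.re (inner ℂ x (T x)) + c * ‖x‖ ^ 2 := by
  have hsa : IsSelfAdjoint T := hT.isSelfAdjoint
  have h : cfc (fun y : ℝ => a * y ^ 2 + b * y + c) T
      = a • T ^ 2 + b • T + algebraMap ℝ (K →L[ℂ] K) c := by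
    rw [cfc_add .., cfc_add .., cfc_const_mul .., cfc_const_mul .., cfc_pow_id .., cfc_id' ..,
      cfc_const ..]
  have h2 : inner ℂ x ((T ^ 2) x) = ((‖T x‖ ^ 2 : ℝ) : ℂ) := by
    rw [pow_two, mul_apply_eq_comp, ← hT.inner_left_eq_inner_right,
      inner_self_eq_norm_sq_to_K]
    norm_cast
  rw [h]
  simp only [add_apply, smul_apply, inner_add_right,
    Algebra.algebraMap_eq_smul_one, one_apply_eq_self, inner_smul_right_eq_smul, h2,
    map_add, inner_self_eq_norm_sq_to_K]
  simp [← Complex.ofReal_pow]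

end Hilbert

/-! ### Number states, density operators and pure states -/

section

variable {n : ℕ}

/-- The number states as a Hilbert basis. -/
noncomputable def numberBasis (n : ℕ) : HilbertBasis (Fin n → ℕ) ℂ (FockSpace n) :=
  HilbertBasis.ofRepr (LinearIsometryEquiv.refl ℂ _)

lemma numberBasis_apply (m : Fin n → ℕ) : numberBasis n m = numberState m := by
  classical
  rw [← HilbertBasis.repr_symm_single]
  simp only [numberBasis, numberState]
  rfl

lemma toFock_single (m : Fin n → ℕ) (z : ℂ) :
    toFock n (Finsupp.single m z) = z • numberState m := by
  simp [toFock]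

lemma inner_numberState_toFock (m : Fin n → ℕ) (g : FiniteVec n) :
    inner ℂ (numberState m) (toFock n g) = g m := by
  have h := orthonormal_iff_ite.1 (numberBasis n).orthonormal m
  simp only [numberBasis_apply] at h
  simp only [toFock, Finsupp.linearCombination_apply, Finsupp.sum, inner_sum, inner_smul_right, h]
  simp only [mul_ite, mul_one, mul_zero, Finset.sum_ite_eq, Finsupp.mem_support_iff]
  split_ifs with h0
  · rfl
  · exact (not_not.1 h0).symm

lemma IsDensityOperator.hasSum_re {σ : FockSpace n →L[ℂ] FockSpace n} (hσ : IsDensityOperator σ) :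
    HasSum (fun m : Fin n → ℕ => RCLike.re (inner ℂ (numberState m) (σ (numberState m)))) 1 := by
  simpa using hσ.trace_eq_one.mapL RCLike.reCLM

lemma IsDensityOperator.tsum_ofReal {ι : Type*} {σ : FockSpace n →L[ℂ] FockSpace n}
    (hσ : IsDensityOperator σ) (b : HilbertBasis ι ℂ (FockSpace n)) :
    ∑' k, ENNReal.ofReal (RCLike.re (inner ℂ (b k) (σ (b k)))) = 1 := by
  rw [tsum_ofReal_re_inner_eq b (numberBasis n) hσ.isPositive]
  simp only [numberBasis_apply]
  rw [← ENNReal.ofReal_tsum_of_nonneg (fun m => hσ.isPositive.re_inner_nonneg_right _)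
    hσ.hasSum_re.summable, hσ.hasSum_re.tsum_eq, ENNReal.ofReal_one]

lemma IsDensityOperator.norm_le_one {σ : FockSpace n →L[ℂ] FockSpace n}
    (hσ : IsDensityOperator σ) : ‖σ‖ ≤ 1 :=
  norm_le_one_of_tsum_eq_one (numberBasis n) hσ.isPositive (hσ.tsum_ofReal _)

lemma isDensityOperator_of_tsum {ι : Type*} {σ : FockSpace n →L[ℂ] FockSpace n}
    (hσ : σ.IsPositive) (b : HilbertBasis ι ℂ (FockSpace n))
    (h1 : ∑' k, ENNReal.ofReal (RCLike.re (inner ℂ (b k) (σ (b k)))) = 1) :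
    IsDensityOperator σ := by
  refine ⟨hσ, ?_⟩
  rw [tsum_ofReal_re_inner_eq b (numberBasis n) hσ] at h1
  simp only [numberBasis_apply] at h1
  have hs : Summable fun m : Fin n → ℕ =>
      RCLike.re (inner ℂ (numberState m) (σ (numberState m))) := by
    refine (ENNReal.summable_toReal (h1.trans_ne ENNReal.one_ne_top)).congr fun m => ?_
    rw [ENNReal.toReal_ofReal (hσ.re_inner_nonneg_right _)]
  rw [← ENNReal.ofReal_tsum_of_nonneg (fun m => hσ.re_inner_nonneg_right _) hs,
    ENNReal.ofReal_eq_one] at h1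
  have h2 := hs.hasSum
  rw [h1] at h2
  have h3 := h2.mapL Complex.ofRealCLM
  simp only [Complex.ofRealCLM_apply, Complex.ofReal_one] at h3
  refine h3.congr_fun fun m => ?_
  exact (RCLike.conj_eq_iff_re.1 (by
    rw [inner_conj_symm, hσ.inner_left_eq_inner_right])).symm

lemma pureState_apply (ψ x : FockSpace n) : pureState ψ x = inner ℂ ψ x • ψ := by
  simp [pureState]

lemma isDensityOperator_pureState {ψ : FockSpace n} (hψ : ‖ψ‖ = 1) :
    IsDensityOperator (pureState ψ) := by
  refine ⟨InnerProductSpace.isPositive_rankOne_self ψ, ?_⟩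
  have h := (numberBasis n).hasSum_inner_mul_inner ψ ψ
  rw [inner_self_eq_norm_sq_to_K, hψ] at h
  simp only [pureState_apply, inner_smul_right]
  simpa [numberBasis_apply] using h

/-! ### The energy as a series, and its lower semicontinuity -/

section Polynomial

variable {t : ℕ} {c : List (Fin n ⊕ Fin n) →₀ ℂ}

lemma hasSum_polynomialOp (hc : ∀ w ∈ c.support, w.length ≤ t)
    {σ : FockSpace n →L[ℂ] FockSpace n} (hσ : HasMoments t σ) :
    HasSum (fun q : (Fin n → ℕ) × (Fin n → ℕ) =>
      polynomialOp c (Finsupp.single q.2 1) q.1 * inner ℂ (numberState q.2) (σ (numberState q.1)))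
      (c.sum fun w z => z * moment σ w) := by
  have h : HasSum (fun q => ∑ w ∈ c.support, c w * momentTerm σ w q)
      (∑ w ∈ c.support, c w * moment σ w) :=
    hasSum_sum fun w hw => (hσ w (hc w hw)).hasSum.mul_left _
  refine h.congr_fun fun q => ?_
  simp only [polynomialOp, Finsupp.sum, LinearMap.sum_apply, LinearMap.smul_apply,
    Finsupp.finsetSum_apply, Finsupp.smul_apply, smul_eq_mul, Finset.sum_mul, momentTerm, mul_assoc]

/-- The energy as an iterated sum. -/
lemma hasSum_inner_apply_polynomialOp (hc : ∀ w ∈ c.support, w.length ≤ t)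
    {σ : FockSpace n →L[ℂ] FockSpace n} (hσ : HasMoments t σ) :
    HasSum (fun m : Fin n → ℕ => inner ℂ (numberState m)
      (σ (toFock n (polynomialOp c (Finsupp.single m 1)))))
      (c.sum fun w z => z * moment σ w) := by
  -- Absolute convergence lets the double series be summed column by column, and each column of the
  -- polynomial is finitely supported.
  have h := (Equiv.prodComm _ _).hasSum_iff.2 (hasSum_polynomialOp hc hσ)
  refine h.prod_fiberwise fun m => ?_
  set g := polynomialOp c (Finsupp.single m 1) with hg
  have h2 : inner ℂ (numberState m) (σ (toFock n g)) =
      ∑ k ∈ g.support, g k * inner ℂ (numberState m) (σ (numberState k)) := by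
    simp only [toFock, Finsupp.linearCombination_apply, Finsupp.sum, map_sum, map_smul, inner_sum,
      inner_smul_right]
  rw [h2]
  refine hasSum_sum_of_ne_finset_zero fun k hk => ?_
  simp only [Function.comp_apply, Equiv.prodComm_apply, Prod.swap_prod_mk, ← hg]
  rw [Finsupp.notMem_support_iff.1 hk, zero_mul]

/-- Lower semicontinuity of the energy: a lower bound of the Hamiltonian by a constant and a
finite-rank operator, valid on finite vectors, passes to states with finite moments. -/
lemma add_sum_re_inner_le_energy {κ : Type*} (hc : ∀ w ∈ c.support, w.length ≤ t)
    {σ : FockSpace n →L[ℂ] FockSpace n} (hσ : IsDensityOperator σ) (hM : HasMoments t σ)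
    (E₀ : ℝ) (A : Finset κ) (u : κ → FockSpace n)
    (hle : ∀ g : FiniteVec n,
      E₀ * ‖toFock n g‖ ^ 2 + ∑ k ∈ A, ‖inner ℂ (u k) (toFock n g)‖ ^ 2 ≤
        RCLike.re (inner ℂ (toFock n g) (toFock n (polynomialOp c g)))) :
    E₀ + ∑ k ∈ A, RCLike.re (inner ℂ (u k) (σ (u k))) ≤
      (c.sum fun w z => z * moment σ w).re := by
  classical
  let T : FiniteVec n →ₗ[ℂ] FockSpace n := toFock n ∘ₗ polynomialOp c - (E₀ : ℂ) • toFock n -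
    ∑ k ∈ A, (pureState (u k)).toLinearMap ∘ₗ toFock n
  have hT : ∀ g, T g = toFock n (polynomialOp c g) - (E₀ : ℂ) • toFock n g -
      ∑ k ∈ A, inner ℂ (u k) (toFock n g) • u k := fun g => by
    simp only [T, pureState_apply, LinearMap.sub_apply, LinearMap.sum_apply, LinearMap.smul_apply,
      LinearMap.comp_apply, ContinuousLinearMap.coe_coe]
  have hTpos : ∀ g, 0 ≤ (inner ℂ (toFock n g) (T g)).re := fun g => by
    have h1 : ∀ k, inner ℂ (u k) (toFock n g) * inner ℂ (toFock n g) (u k) =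
        ((‖inner ℂ (u k) (toFock n g)‖ ^ 2 : ℝ) : ℂ) := fun k => by
      rw [← inner_conj_symm _ (u k), RCLike.mul_conj]
      norm_cast
    rw [hT, inner_sub_right, inner_sub_right, inner_sum, inner_smul_right,
      inner_self_eq_norm_sq_to_K]
    have := hle g
    simp only [inner_smul_right, h1, RCLike.re_eq_complex_re, Complex.coe_algebraMap,
      ← Complex.ofReal_pow, ← Complex.ofReal_mul, ← Complex.ofReal_sum, Complex.sub_re,
      Complex.ofReal_re] at this ⊢
    linarith
  let L : (Fin n → ℕ) → (Fin n → ℕ) → ℂ := fun m m' =>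
    inner ℂ (numberState m) (T (Finsupp.single m' 1))
  have hF : ∀ F : Finset (Fin n → ℕ), 0 ≤ (∑ m ∈ F, ∑ m' ∈ F,
      L m m' * inner ℂ (numberState m') (σ (numberState m))).re := fun F => by
    have := re_sum_mul_inner_nonneg (numberBasis n) hσ.isPositive F L fun f => ?_
    · simpa only [numberBasis_apply] using this
    · refine (hTpos (∑ m ∈ F, f m • Finsupp.single m 1)).trans_eq (congrArg Complex.re ?_)
      simp only [map_sum, map_smul, toFock_single, one_smul, sum_inner, inner_sum, inner_smul_left,
        inner_smul_right, L, mul_assoc, Finset.mul_sum]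
      rw [Finset.sum_comm]
      refine Finset.sum_congr rfl fun m _ => Finset.sum_congr rfl fun m' _ => ?_
      ring
  -- Truncating `u_k` to `F` makes the rank-one part of the finite section equal to `⟨v, σ v⟩`,
  -- whose limit follows from continuity of `σ`.
  let v : κ → Finset (Fin n → ℕ) → FockSpace n := fun k F =>
    ∑ m ∈ F, inner ℂ (numberState m) (u k) • numberState m
  have hv : ∀ k, Tendsto (v k) atTop (𝓝 (u k)) := fun k => by
    have h : HasSum _ (u k) := (numberBasis n).hasSum_repr (u k)
    simp only [HilbertBasis.repr_apply_apply, numberBasis_apply] at h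
    exact h
  have hsum : ∀ F : Finset (Fin n → ℕ), ∑ m ∈ F, ∑ m' ∈ F,
      L m m' * inner ℂ (numberState m') (σ (numberState m)) =
      ∑ q ∈ F ×ˢ F, polynomialOp c (Finsupp.single q.2 1) q.1 *
        inner ℂ (numberState q.2) (σ (numberState q.1)) -
      E₀ * ∑ m ∈ F, inner ℂ (numberState m) (σ (numberState m)) -
      ∑ k ∈ A, inner ℂ (v k F) (σ (v k F)) := fun F => by
    have h1 : ∀ k, inner ℂ (v k F) (σ (v k F)) = ∑ m ∈ F, ∑ m' ∈ F,
        inner ℂ (u k) (numberState m') * inner ℂ (numberState m) (u k) *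
          inner ℂ (numberState m') (σ (numberState m)) := fun k => by
      simp only [v, map_sum, map_smul, sum_inner, inner_sum, inner_smul_left, inner_smul_right,
        inner_conj_symm, Finset.mul_sum]
      refine Finset.sum_congr rfl fun m _ => Finset.sum_congr rfl fun m' _ => ?_
      ring
    have h2 : ∑ m ∈ F, inner ℂ (numberState m) (σ (numberState m)) = ∑ m ∈ F, ∑ m' ∈ F,
        inner ℂ (numberState m) (numberState m') *
          inner ℂ (numberState m') (σ (numberState m)) := by
      refine Finset.sum_congr rfl fun m hm => ?_
      have h := orthonormal_iff_ite.1 (numberBasis n).orthonormal m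
      simp only [numberBasis_apply] at h
      simp [h, hm]
    have h3 : ∑ k ∈ A, inner ℂ (v k F) (σ (v k F)) = ∑ m ∈ F, ∑ m' ∈ F,
        (∑ k ∈ A, inner ℂ (u k) (numberState m') * inner ℂ (numberState m) (u k)) *
          inner ℂ (numberState m') (σ (numberState m)) := by
      simp only [h1, Finset.sum_mul]
      rw [Finset.sum_comm]
      exact Finset.sum_congr rfl fun m _ => Finset.sum_comm
    rw [h2, h3, Finset.sum_product, Finset.mul_sum]
    simp only [Finset.mul_sum, ← Finset.sum_sub_distrib]
    refine Finset.sum_congr rfl fun m _ => Finset.sum_congr rfl fun m' _ => ?_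
    simp only [L, hT, inner_sub_right, inner_numberState_toFock, inner_smul_right, toFock_single,
      one_smul, inner_sum]
    ring
  have hlim : Tendsto (fun F : Finset (Fin n → ℕ) => (∑ m ∈ F, ∑ m' ∈ F,
      L m m' * inner ℂ (numberState m') (σ (numberState m))).re) atTop
      (𝓝 ((c.sum fun w z => z * moment σ w) - E₀ * 1 -
        ∑ k ∈ A, inner ℂ (u k) (σ (u k))).re) := by
    simp only [hsum]
    refine (Complex.continuous_re.tendsto _).comp (Tendsto.sub (Tendsto.sub ?_ ?_) ?_)
    -- The squares `F ×ˢ F` tend to infinity among finite sets of pairs, so the double series may be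
    -- evaluated along them.
    · have hd : Tendsto (fun F : Finset (Fin n → ℕ) => F ×ˢ F) atTop atTop :=
        tendsto_finsetProd_atTop.comp tendsto_atTop_diagonal
      have h : Tendsto _ _ _ := hasSum_polynomialOp hc hM
      exact h.comp hd
    · have h : Tendsto _ _ _ := hσ.trace_eq_one
      exact h.const_mul (E₀ : ℂ)
    · exact tendsto_finsetSum _ fun k _ => (hv k).inner ((σ.continuous.tendsto _).comp (hv k))
  have := ge_of_tendsto' hlim hF
  simp only [Complex.sub_re, Complex.re_sum, mul_one, Complex.ofReal_re] at this
  simp only [RCLike.re_eq_complex_re]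
  linarith

end Polynomial

end

/-! ### Self-adjoint Hamiltonians and the pure case -/

section

section SelfAdjoint

variable {K : Type*} [NormedAddCommGroup K] [InnerProductSpace ℂ K] [CompleteSpace K]
  {H : K →ₗ.[ℂ] K}

lemma inner_apply_eq_of_isSelfAdjoint (hH : IsSelfAdjoint H) (x y : H.domain) :
    inner ℂ (H x) (y : K) = inner ℂ (x : K) (H y) := by
  have h := H.adjoint_isFormalAdjoint hH.dense_domain
  rw [LinearPMap.isSelfAdjoint_def.1 hH] at h
  exact h x y

/-- A weak solution lies in the domain of the adjoint, which is `H` itself. This is where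
self-adjointness, rather than symmetry, matters. -/
lemma exists_apply_eq_of_isSelfAdjoint (hH : IsSelfAdjoint H) {y w : K}
    (h : ∀ x : H.domain, inner ℂ w (x : K) = inner ℂ y (H x)) :
    ∃ hy : y ∈ H.domain, H ⟨y, hy⟩ = w := by
  have h1 : ∃ hy : y ∈ H.adjoint.domain, H.adjoint ⟨y, hy⟩ = w :=
    ⟨H.mem_adjoint_domain_of_exists y ⟨w, h⟩, LinearPMap.adjoint_apply_eq hH.dense_domain _ h⟩
  rwa [LinearPMap.isSelfAdjoint_def.1 hH] at h1

/-- The Cauchy–Schwarz inequality for the form of `H - E`. -/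
lemma norm_inner_sub_smul_sq_le (hH : IsSelfAdjoint H) {E : ℝ}
    (hE : ∀ φ : H.domain, E * ‖(φ : K)‖ ^ 2 ≤ RCLike.re (inner ℂ (φ : K) (H φ)))
    (χ φ : H.domain) :
    ‖inner ℂ (H χ - (E : ℂ) • (χ : K)) (φ : K)‖ ^ 2 ≤
      (RCLike.re (inner ℂ (χ : K) (H χ)) - E * ‖(χ : K)‖ ^ 2) *
        (RCLike.re (inner ℂ (φ : K) (H φ)) - E * ‖(φ : K)‖ ^ 2) := by
  have hre : ∀ x : H.domain, RCLike.re (inner ℂ (H x - (E : ℂ) • (x : K)) (x : K)) =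
      RCLike.re (inner ℂ (x : K) (H x)) - E * ‖(x : K)‖ ^ 2 := fun x => by
    rw [inner_sub_left, inner_smul_left, inner_apply_eq_of_isSelfAdjoint hH,
      inner_self_eq_norm_sq_to_K, map_sub]
    simp [← Complex.ofReal_pow]
  -- The form of `H - E` is only semidefinite, since it vanishes on ground states.
  let C : PreInnerProductSpace.Core ℂ H.domain :=
    { inner := fun x y => inner ℂ (H x - (E : ℂ) • (x : K)) (y : K)
      conj_inner_symm := fun x y => by
        rw [inner_conj_symm, inner_sub_left, inner_sub_right, inner_smul_left, inner_smul_right,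
          inner_apply_eq_of_isSelfAdjoint hH, Complex.conj_ofReal]
      re_inner_nonneg := fun x => by
        rw [hre]
        linarith [hE x]
      add_left := fun x y z => by
        rw [← inner_add_left]
        congr 1
        rw [H.map_add, Submodule.coe_add, smul_add]
        abel
      smul_left := fun x y r => by
        rw [← inner_smul_left]
        congr 1
        rw [H.map_smul, Submodule.coe_smul, smul_sub, smul_comm] }
  have h := @InnerProductSpace.Core.inner_mul_inner_self_le ℂ H.domain _ _ _ C χ φ
  have h2 : ‖inner ℂ (H φ - (E : ℂ) • (φ : K)) (χ : K)‖ =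
      ‖inner ℂ (H χ - (E : ℂ) • (χ : K)) (φ : K)‖ := by
    have h3 : (starRingEnd ℂ) (inner ℂ (H φ - (E : ℂ) • (φ : K)) (χ : K)) =
      inner ℂ (H χ - (E : ℂ) • (χ : K)) (φ : K) := C.conj_inner_symm χ φ
    rw [← h3]
    exact (RCLike.norm_conj _).symm
  change ‖inner ℂ (H χ - (E : ℂ) • (χ : K)) (φ : K)‖ *
    ‖inner ℂ (H φ - (E : ℂ) • (φ : K)) (χ : K)‖ ≤
    RCLike.re (inner ℂ (H χ - (E : ℂ) • (χ : K)) (χ : K)) *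
    RCLike.re (inner ℂ (H φ - (E : ℂ) • (φ : K)) (φ : K)) at h
  rwa [h2, ← pow_two, hre, hre] at h

end SelfAdjoint

variable {n t : ℕ} {c : List (Fin n ⊕ Fin n) →₀ ℂ} {H : FockSpace n →ₗ.[ℂ] FockSpace n}

lemma IsHamiltonian.inner_polynomialOp (hH : IsHamiltonian t c H) {E : ℝ} {ψ : FockSpace n}
    (hψ : ∃ h : ψ ∈ H.domain, H ⟨ψ, h⟩ = (E : ℂ) • ψ) (g : FiniteVec n) :
    inner ℂ ψ (toFock n (polynomialOp c g)) = E * inner ℂ ψ (toFock n g) := by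
  obtain ⟨hd, hE⟩ := hψ
  obtain ⟨hg, hgE⟩ := hH.extends_polynomial g
  rw [← hgE, ← inner_apply_eq_of_isSelfAdjoint hH.selfAdjoint ⟨ψ, hd⟩ ⟨_, hg⟩, hE,
    inner_smul_left, Complex.conj_ofReal]

lemma IsHamiltonian.le_inner_polynomialOp (hH : IsHamiltonian t c H) {E : ℝ}
    (hE : ∀ φ : H.domain,
      E * ‖(φ : FockSpace n)‖ ^ 2 ≤ RCLike.re (inner ℂ (φ : FockSpace n) (H φ)))
    (g : FiniteVec n) :
    E * ‖toFock n g‖ ^ 2 ≤ RCLike.re (inner ℂ (toFock n g) (toFock n (polynomialOp c g))) := by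
  obtain ⟨hg, hgE⟩ := hH.extends_polynomial g
  rw [← hgE]
  exact hE ⟨_, hg⟩

/-- By symmetry the polynomial acting on a number state moves onto `ψ` as the factor `E`; Parseval
then sums the series. -/
lemma energy_eq_of_eigenvector (hH : IsHamiltonian t c H) {E : ℝ} {ψ : FockSpace n}
    (h1 : ‖ψ‖ = 1) (hψ : ∃ h : ψ ∈ H.domain, H ⟨ψ, h⟩ = (E : ℂ) • ψ)
    (hM : HasMoments t (pureState ψ)) :
    (E : ℂ) = c.sum fun w z => z * moment (pureState ψ) w := by
  have h := hasSum_inner_apply_polynomialOp hH.degree_le hM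
  have h2 := ((numberBasis n).hasSum_inner_mul_inner ψ ψ).mul_left (E : ℂ)
  rw [inner_self_eq_norm_sq_to_K, h1] at h2
  simp only [map_one, one_pow, mul_one, numberBasis_apply] at h2
  refine h2.unique (h.congr_fun fun m => ?_)
  rw [pureState_apply, inner_smul_right, hH.inner_polynomialOp hψ, toFock_single, one_smul,
    mul_assoc]

lemma le_energy (hH : IsHamiltonian t c H) {E : ℝ}
    (hE : ∀ φ : H.domain,
      E * ‖(φ : FockSpace n)‖ ^ 2 ≤ RCLike.re (inner ℂ (φ : FockSpace n) (H φ)))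
    {σ : FockSpace n →L[ℂ] FockSpace n} (hσ : IsDensityOperator σ) (hM : HasMoments t σ) :
    E ≤ (c.sum fun w z => z * moment σ w).re := by
  have h := add_sum_re_inner_le_energy hH.degree_le hσ hM E (∅ : Finset Unit) (fun _ => 0)
    fun g => ?_
  · simpa using h
  · simpa using hH.le_inner_polynomialOp hE g

/-- A state whose energy is the ground state energy is annihilated by `H - E`. -/
lemma apply_sub_smul_eq_zero_of_energy_eq (hH : IsHamiltonian t c H) {E : ℝ}
    (hE : ∀ φ : H.domain,
      E * ‖(φ : FockSpace n)‖ ^ 2 ≤ RCLike.re (inner ℂ (φ : FockSpace n) (H φ)))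
    {σ : FockSpace n →L[ℂ] FockSpace n} (hσ : IsDensityOperator σ) (hM : HasMoments t σ)
    (hEσ : (c.sum fun w z => z * moment σ w).re = E) (χ : H.domain) :
    σ (H χ - (E : ℂ) • (χ : FockSpace n)) = 0 := by
  set a := RCLike.re (inner ℂ (χ : FockSpace n) (H χ)) - E * ‖(χ : FockSpace n)‖ ^ 2 with ha
  have ha0 : 0 ≤ a := sub_nonneg.2 (hE χ)
  -- Cauchy–Schwarz gives `‖⟨(H - E)χ, g⟩‖² ≤ a · ⟨g, (H - E)g⟩`, so scaling by `r` with `r² a ≤ 1`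
  -- suffices. The `+ 1` covers `a = 0`.
  set r : ℝ := (Real.sqrt (a + 1))⁻¹ with hr
  have hr0 : 0 < r := inv_pos.2 (Real.sqrt_pos.2 (by linarith))
  have hr2 : r ^ 2 * (a + 1) = 1 := by
    rw [hr, inv_pow, Real.sq_sqrt (by linarith)]
    exact inv_mul_cancel₀ (by linarith)
  have h := add_sum_re_inner_le_energy hH.degree_le hσ hM E (Finset.univ : Finset Unit)
    (fun _ => (r : ℂ) • (H χ - (E : ℂ) • (χ : FockSpace n))) fun g => ?_
  · have h0 := apply_eq_zero_of_re_inner_eq_zero hσ.isPositive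
      (x := (r : ℂ) • (H χ - (E : ℂ) • (χ : FockSpace n))) (by simpa [hEσ] using h)
    rw [map_smul] at h0
    exact (smul_eq_zero.1 h0).resolve_left (by exact_mod_cast hr0.ne')
  · have hle := hH.le_inner_polynomialOp hE g
    obtain ⟨hg, hgE⟩ := hH.extends_polynomial g
    have hcs := norm_inner_sub_smul_sq_le hH.selfAdjoint hE χ ⟨_, hg⟩
    rw [hgE, ← ha] at hcs
    simp only [Finset.univ_unique, Finset.sum_singleton, inner_smul_left, Complex.conj_ofReal,
      norm_mul, mul_pow, Complex.norm_real, Real.norm_eq_abs, sq_abs]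
    nlinarith [mul_le_mul_of_nonneg_left hcs (sq_nonneg r), sq_nonneg r]

/-- Since `σ` annihilates the range of `H - E`, each `σ y` is a weak, hence genuine, eigenvector for
`E`, so a multiple of `ψ`. Symmetry makes `σ` a multiple of the projection, and the trace fixes the
factor. -/
lemma eq_pureState_of_energy_eq (hH : IsHamiltonian t c H) {E : ℝ} {ψ : FockSpace n}
    (hψ : IsUniqueGroundState H E ψ)
    {σ : FockSpace n →L[ℂ] FockSpace n} (hσ : IsDensityOperator σ) (hM : HasMoments t σ)
    (hEσ : (c.sum fun w z => z * moment σ w).re = E) : σ = pureState ψ := by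
  have hsymm := hσ.isPositive.inner_left_eq_inner_right
  have hrange : ∀ y, ∃ z : ℂ, σ y = z • ψ := fun y => by
    obtain ⟨hy, hyE⟩ := exists_apply_eq_of_isSelfAdjoint hH.selfAdjoint (y := σ y)
      (w := (E : ℂ) • σ y) fun x => by
        have h := apply_sub_smul_eq_zero_of_energy_eq hH hψ.energy_le hσ hM hEσ x
        have h2 : inner ℂ (σ y) (H x - (E : ℂ) • (x : FockSpace n)) = 0 := by
          rw [hsymm, h, inner_zero_right]
        rw [inner_sub_right, inner_smul_right, sub_eq_zero] at h2
        rw [inner_smul_left, Complex.conj_ofReal, h2]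
    exact hψ.nondegenerate ⟨_, hy⟩ hyE
  have hψψ : inner ℂ ψ ψ = 1 := by
    rw [inner_self_eq_norm_sq_to_K, hψ.norm_eq_one]
    simp
  obtain ⟨z, hz⟩ := hrange ψ
  have hσψ : σ = (starRingEnd ℂ) z • pureState ψ := by
    ext1 y
    obtain ⟨z', hz'⟩ := hrange y
    have : z' = (starRingEnd ℂ) z * inner ℂ ψ y := by
      rw [← inner_smul_left, ← hz, hsymm, hz', inner_smul_right, hψψ, mul_one]
    rw [hz', this, smul_apply, pureState_apply, smul_smul]
  have h1 : (starRingEnd ℂ) z * 1 = 1 := by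
    refine ((isDensityOperator_pureState hψ.norm_eq_one).trace_eq_one.mul_left _).unique
      (hσ.trace_eq_one.congr_fun fun m => ?_)
    rw [hσψ, smul_apply, inner_smul_right]
  rw [hσψ, ← mul_one ((starRingEnd ℂ) z), h1, one_smul]

lemma exists_phase_of_pureState_eq {φ ψ : FockSpace n} (hφ : ‖φ‖ = 1) (hψ : ‖ψ‖ = 1)
    (h : pureState φ = pureState ψ) : ∃ u : ℂ, ‖u‖ = 1 ∧ φ = u • ψ := by
  have h1 : pureState φ φ = φ := by
    rw [pureState_apply, inner_self_eq_norm_sq_to_K, hφ]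
    simp
  rw [h, pureState_apply] at h1
  refine ⟨inner ℂ ψ φ, ?_, h1.symm⟩
  rw [← hφ, ← mul_one ‖inner ℂ ψ φ‖, ← hψ, ← norm_smul, h1]

end

/-! ### Klein's inequality and the mixed case -/

section

section Entropy

/-- The Bregman remainder `x log x - x log p - x + p` dominates `(√x - √p)²`, by `log y ≤ y - 1` at
`y = √p / √x`. On `[0, 1]`, `(√x + √p)² ≤ 4`, which gives the constant `1/4`. -/
lemma negMulLog_le_quadratic {p x : ℝ} (hp : 0 < p) (hp1 : p ≤ 1) (hx : 0 ≤ x) (hx1 : x ≤ 1) :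
    Real.negMulLog x ≤ -(1 / 4) * x ^ 2 + (-Real.log p - 1 + p / 2) * x + (p - p ^ 2 / 4) := by
  suffices h : (x - p) ^ 2 / 4 ≤ x * Real.log x - x * Real.log p - x + p by
    rw [Real.negMulLog]
    nlinarith
  have hsx := Real.sq_sqrt hx
  have hsp := Real.sq_sqrt hp.le
  have hx1' := Real.sqrt_le_one.2 hx1
  have hp1' := Real.sqrt_le_one.2 hp1
  have hx0' := Real.sqrt_nonneg x
  have hp0' := Real.sqrt_pos.2 hp
  set a := Real.sqrt x
  set b := Real.sqrt p
  have h1 : (a - b) ^ 2 ≤ x * Real.log x - x * Real.log p - x + p := by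
    rcases hx0'.eq_or_lt with ha | ha
    · have : x = 0 := by rw [← hsx, ← ha]; ring
      simp [this, ← ha, hsp]
    · have h2 := Real.log_le_sub_one_of_pos (div_pos hp0' ha)
      rw [Real.log_div hp0'.ne' ha.ne'] at h2
      have h3 : a ^ 2 * (Real.log b - Real.log a) ≤ a * b - a ^ 2 := by
        calc _ ≤ a ^ 2 * (b / a - 1) := mul_le_mul_of_nonneg_left h2 (sq_nonneg a)
          _ = a * b - a ^ 2 := by field_simp
      rw [← hsx, ← hsp, Real.log_pow, Real.log_pow]
      push_cast
      nlinarith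
  refine le_trans ?_ h1
  rw [← hsx, ← hsp]
  have h4 : (a + b) ^ 2 ≤ 4 := by nlinarith
  calc (a ^ 2 - b ^ 2) ^ 2 / 4 = (a - b) ^ 2 * ((a + b) ^ 2 / 4) := by ring
    _ ≤ (a - b) ^ 2 * 1 := mul_le_mul_of_nonneg_left (by linarith) (sq_nonneg _)
    _ = _ := mul_one _

/-- This lower bound touches at `x = p`, as does the upper one. Together they pin down the entropy
term at an eigenvector. -/
lemma quadratic_le_negMulLog {p x : ℝ} (hp : 0 < p) (hx : 0 ≤ x) :
    -(1 / p) * x ^ 2 + (1 - Real.log p) * x + 0 ≤ Real.negMulLog x := by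
  rcases hx.eq_or_lt with rfl | hx
  · simp
  have h := Real.log_le_sub_one_of_pos (div_pos hx hp)
  rw [Real.log_div hx.ne' hp.ne'] at h
  have h2 := mul_le_mul_of_nonneg_left h hx.le
  have h3 : x * (x / p - 1) = 1 / p * x ^ 2 - x := by ring
  rw [Real.negMulLog]
  linarith

variable {K : Type*} [NormedAddCommGroup K] [InnerProductSpace ℂ K] [CompleteSpace K]
  {T : K →L[ℂ] K} {p : ℝ} {x : K}

/-- A quantitative Klein inequality. -/
lemma re_inner_negMulLogOp_add_le (hT : T.IsPositive) (hT1 : ‖T‖ ≤ 1) (hp : 0 < p) (hp1 : p ≤ 1)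
    (hx : ‖x‖ = 1) :
    RCLike.re (inner ℂ x (negMulLogOp T x)) + 1 / 4 * ‖T x - (p : ℂ) • x‖ ^ 2 +
      RCLike.re (inner ℂ x (T x)) ≤ -Real.log p * RCLike.re (inner ℂ x (T x)) + p := by
  have h := re_inner_cfc_le hT hT1 Real.continuous_negMulLog
    (g := fun y : ℝ => -(1 / 4) * y ^ 2 + (-Real.log p - 1 + p / 2) * y + (p - p ^ 2 / 4))
    (by fun_prop) (fun y => negMulLog_le_quadratic hp hp1) x
  rw [re_inner_cfc_quadratic hT, hx] at h
  have h2 : ‖T x - (p : ℂ) • x‖ ^ 2 =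
      ‖T x‖ ^ 2 - 2 * (p * RCLike.re (inner ℂ x (T x))) + p ^ 2 := by
    rw [@norm_sub_sq ℂ, inner_smul_right, norm_smul, hx, hT.inner_left_eq_inner_right]
    simp
  rw [h2, negMulLogOp]
  linarith

lemma re_inner_negMulLogOp_of_apply_eq (hT : T.IsPositive) (hT1 : ‖T‖ ≤ 1) (hp : 0 < p)
    (hp1 : p ≤ 1) (hx : ‖x‖ = 1) (hTx : T x = (p : ℂ) • x) :
    RCLike.re (inner ℂ x (negMulLogOp T x)) = p * -Real.log p := by
  have hin : RCLike.re (inner ℂ x (T x)) = p := by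
    rw [hTx, inner_smul_right, inner_self_eq_norm_sq_to_K, hx]
    simp
  refine le_antisymm ?_ ?_
  · have h := re_inner_negMulLogOp_add_le hT hT1 hp hp1 hx
    rw [hin, hTx, sub_self, norm_zero] at h
    linarith
  · have h := re_inner_cfc_le hT hT1 (g := Real.negMulLog)
      (f := fun y : ℝ => -(1 / p) * y ^ 2 + (1 - Real.log p) * y + 0)
      (by fun_prop) Real.continuous_negMulLog (fun y hy _ => quadratic_le_negMulLog hp hy) x
    have h2 : ‖T x‖ ^ 2 = p ^ 2 := by rw [hTx, norm_smul, hx]; simp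
    rw [re_inner_cfc_quadratic hT, hin, h2, hx] at h
    have h3 : -(1 / p) * p ^ 2 = -p := by field_simp
    rw [negMulLogOp]
    linarith

lemma isPositive_negMulLogOp (hT : T.IsPositive) (hT1 : ‖T‖ ≤ 1) : (negMulLogOp T).IsPositive :=
  isPositive_cfc hT hT1 fun _ => Real.negMulLog_nonneg

end Entropy

variable {n t : ℕ} {c : List (Fin n ⊕ Fin n) →₀ ℂ} {H : FockSpace n →ₗ.[ℂ] FockSpace n}
  {ι : Type*} {e : HilbertBasis ι ℂ (FockSpace n)} {p E : ι → ℝ}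
  {ρ σ : FockSpace n →L[ℂ] FockSpace n}

/-- Entropy is defined in the number basis, while Klein's inequality is summed over an eigenbasis of
`H`. -/
lemma entropy_eq_tsum (hσ : IsDensityOperator σ) (e : HilbertBasis ι ℂ (FockSpace n)) :
    entropy σ = ∑' k, ENNReal.ofReal (RCLike.re (inner ℂ (e k) (negMulLogOp σ (e k)))) := by
  rw [tsum_ofReal_re_inner_eq e (numberBasis n)
    (isPositive_negMulLogOp hσ.isPositive hσ.norm_le_one)]
  simp only [numberBasis_apply, entropy]

section Diagonal

lemma hasSum_inner_apply_of_diagonal (hρ : ∀ k, ρ (e k) = (p k : ℂ) • e k) (x y : FockSpace n) :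
    HasSum (fun k => (p k : ℂ) * (inner ℂ x (e k) * inner ℂ (e k) y)) (inner ℂ x (ρ y)) := by
  have h := ((e.hasSum_repr y).mapL ρ).mapL (innerSL ℂ x)
  refine h.congr_fun fun k => ?_
  rw [map_smul, hρ, innerSL_apply_apply, inner_smul_right, inner_smul_right,
    HilbertBasis.repr_apply_apply]
  ring

lemma inner_mul_inner_symm (x y : FockSpace n) :
    inner ℂ x y * inner ℂ y x = ((‖inner ℂ y x‖ ^ 2 : ℝ) : ℂ) := by
  rw [← inner_conj_symm x y, RCLike.conj_mul]
  norm_cast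

lemma isDensityOperator_of_diagonal (hρ : ∀ k, ρ (e k) = (p k : ℂ) • e k) (hp : ∀ k, 0 ≤ p k)
    (hp1 : HasSum p 1) : IsDensityOperator ρ := by
  have hx : ∀ x, HasSum (fun k => p k * ‖inner ℂ (e k) x‖ ^ 2)
      (RCLike.re (inner ℂ x (ρ x))) ∧
      inner ℂ x (ρ x) = (RCLike.re (inner ℂ x (ρ x)) : ℂ) := fun x => by
    have h := hasSum_inner_apply_of_diagonal hρ x x
    simp only [inner_mul_inner_symm, ← Complex.ofReal_mul] at h
    have h2 : HasSum (fun k => p k * ‖inner ℂ (e k) x‖ ^ 2) (RCLike.re (inner ℂ x (ρ x))) := by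
      simpa [-Complex.ofReal_pow] using h.mapL RCLike.reCLM
    exact ⟨h2, h.unique (h2.mapL Complex.ofRealCLM)⟩
  have hpos : ρ.IsPositive := by
    rw [ContinuousLinearMap.isPositive_iff_complex]
    intro x
    rw [← inner_conj_symm, (hx x).2]
    refine ⟨by simp, ?_⟩
    simpa using (hx x).1.nonneg fun k => mul_nonneg (hp k) (sq_nonneg _)
  refine isDensityOperator_of_tsum hpos e ?_
  have h1 : ∀ k, RCLike.re (inner ℂ (e k) (ρ (e k))) = p k := fun k => by
    rw [hρ, inner_smul_right, inner_self_eq_norm_sq_to_K, e.orthonormal.1]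
    simp
  simp only [h1]
  rw [← ENNReal.ofReal_tsum_of_nonneg hp hp1.summable, hp1.tsum_eq, ENNReal.ofReal_one]

end Diagonal

section Energy

lemma hasSum_energy_of_eigenbasis (hH : IsHamiltonian t c H)
    (he : ∀ k, ∃ h : e k ∈ H.domain, H ⟨e k, h⟩ = (E k : ℂ) • e k) (g : FiniteVec n) :
    HasSum (fun k => E k * ‖inner ℂ (e k) (toFock n g)‖ ^ 2)
      (RCLike.re (inner ℂ (toFock n g) (toFock n (polynomialOp c g)))) := by
  have h := (e.hasSum_inner_mul_inner (toFock n g) (toFock n (polynomialOp c g))).mapL RCLike.reCLM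
  refine h.congr_fun fun k => ?_
  rw [hH.inner_polynomialOp (he k), mul_left_comm, inner_mul_inner_symm]
  simp [-Complex.ofReal_pow]

/-- The energy of a state dominates its energy distribution in an eigenbasis. -/
lemma tsum_energy_le (hH : IsHamiltonian t c H)
    (he : ∀ k, ∃ h : e k ∈ H.domain, H ⟨e k, h⟩ = (E k : ℂ) • e k) {E₀ : ℝ}
    (hE : ∀ k, E₀ ≤ E k) (hσ : IsDensityOperator σ) (hM : HasMoments t σ) :
    ∑' k, ENNReal.ofReal ((E k - E₀) * RCLike.re (inner ℂ (e k) (σ (e k)))) ≤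
      ENNReal.ofReal ((c.sum fun w z => z * moment σ w).re - E₀) := by
  rw [ENNReal.tsum_eq_iSup_sum]
  refine iSup_le fun A => ?_
  have hs : ∀ k, ((Real.sqrt (E k - E₀) : ℝ) : ℂ) * ((Real.sqrt (E k - E₀) : ℝ) : ℂ) =
      ((E k - E₀ : ℝ) : ℂ) := fun k => by
    rw [← Complex.ofReal_mul, Real.mul_self_sqrt (sub_nonneg.2 (hE k))]
  -- These vectors make the rank-one sum a spectral truncation of `H - E₀`, which lies below it
  -- because the omitted terms are nonnegative.
  have h := add_sum_re_inner_le_energy hH.degree_le hσ hM E₀ A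
    (fun k => ((Real.sqrt (E k - E₀) : ℝ) : ℂ) • e k) fun g => ?_
  · rw [← ENNReal.ofReal_sum_of_nonneg fun k _ => mul_nonneg (sub_nonneg.2 (hE k))
      (hσ.isPositive.re_inner_nonneg_right _)]
    refine ENNReal.ofReal_le_ofReal ?_
    simp only [map_smul, inner_smul_left, inner_smul_right, Complex.conj_ofReal, ← mul_assoc,
      hs] at h
    simp only [RCLike.re_eq_complex_re, Complex.re_ofReal_mul] at h ⊢
    linarith
  · have h1 := (hasSum_energy_of_eigenbasis hH he g).sub
      ((hasSum_norm_inner_sq e (toFock n g)).mul_left E₀)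
    have h2 := sum_le_hasSum A (fun k _ => ?_) h1
    · simp only [inner_smul_left, Complex.conj_ofReal, norm_mul, mul_pow, Complex.norm_real,
        Real.norm_eq_abs, sq_abs, Real.sq_sqrt (sub_nonneg.2 (hE _)), sub_mul]
      linarith
    · rw [← sub_mul]
      exact mul_nonneg (sub_nonneg.2 (hE k)) (sq_nonneg _)

/-- The energy of a state that is diagonal in an eigenbasis of the Hamiltonian. -/
lemma tsum_energy_eq_of_diagonal (hH : IsHamiltonian t c H)
    (he : ∀ k, ∃ h : e k ∈ H.domain, H ⟨e k, h⟩ = (E k : ℂ) • e k) {E₀ : ℝ}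
    (hE : ∀ k, E₀ ≤ E k) (hp : ∀ k, 0 ≤ p k) (hρ : ∀ k, ρ (e k) = (p k : ℂ) • e k)
    (hd : IsDensityOperator ρ) (hM : HasMoments t ρ) :
    ∑' k, ENNReal.ofReal (p k * (E k - E₀)) =
      ENNReal.ofReal ((c.sum fun w z => z * moment ρ w).re - E₀) := by
  have hterm : ∀ m : Fin n → ℕ, HasSum (fun k => p k * (E k - E₀) *
      ‖inner ℂ (e k) (numberState m)‖ ^ 2)
      (RCLike.re (inner ℂ (numberState m)
        (ρ (toFock n (polynomialOp c (Finsupp.single m 1))))) -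
      E₀ * RCLike.re (inner ℂ (numberState m) (ρ (numberState m)))) := fun m => by
    have h1 := (hasSum_inner_apply_of_diagonal hρ (numberState m)
      (toFock n (polynomialOp c (Finsupp.single m 1)))).mapL RCLike.reCLM
    have h2 := ((hasSum_inner_apply_of_diagonal hρ (numberState m) (numberState m)).mapL
      RCLike.reCLM).mul_left E₀
    refine (h1.sub h2).congr_fun fun k => ?_
    rw [hH.inner_polynomialOp (he k), toFock_single, one_smul, mul_left_comm (inner ℂ _ _),
      inner_mul_inner_symm]
    simp only [RCLike.reCLM_apply, RCLike.re_eq_complex_re, Complex.re_ofReal_mul,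
      Complex.ofReal_re]
    ring
  have hnn : ∀ m k, 0 ≤ p k * (E k - E₀) * ‖inner ℂ (e k) (numberState (n := n) m)‖ ^ 2 :=
    fun m k => mul_nonneg (mul_nonneg (hp k) (sub_nonneg.2 (hE k))) (sq_nonneg _)
  have htot := ((hasSum_inner_apply_polynomialOp hH.degree_le hM).mapL RCLike.reCLM).sub
    (hd.hasSum_re.mul_left E₀)
  rw [mul_one] at htot
  have htot' := htot.tsum_eq
  simp only [RCLike.reCLM_apply, RCLike.re_eq_complex_re] at htot htot' hterm
  rw [← htot', ENNReal.ofReal_tsum_of_nonneg (fun m => (hterm m).nonneg (hnn m)) htot.summable]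
  have h3 : ∀ m : Fin n → ℕ, ENNReal.ofReal ((inner ℂ (numberState m)
        (ρ (toFock n (polynomialOp c (Finsupp.single m 1))))).re -
      E₀ * (inner ℂ (numberState m) (ρ (numberState m))).re) =
      ∑' k, ENNReal.ofReal (p k * (E k - E₀)) *
        ENNReal.ofReal (‖inner ℂ (numberBasis n m) (e k)‖ ^ 2) := fun m => by
    rw [← (hterm m).tsum_eq, ENNReal.ofReal_tsum_of_nonneg (hnn m) (hterm m).summable]
    refine tsum_congr fun k => ?_
    rw [ENNReal.ofReal_mul (mul_nonneg (hp k) (sub_nonneg.2 (hE k))), numberBasis_apply,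
      norm_inner_symm]
  simp only [h3]
  -- All terms are nonnegative, so Tonelli exchanges number states with eigenstates; the inner sum
  -- is then `‖e_k‖² = 1`.
  rw [ENNReal.tsum_comm]
  refine tsum_congr fun k => ?_
  rw [ENNReal.tsum_mul_left, tsum_ofReal_norm_inner_sq, e.orthonormal.1]
  simp

end Energy

lemma gibbs_maximizes_entropy (hH : IsHamiltonian t c H) {β : ℝ} (hβ : 0 < β)
    (hG : IsGibbsState H β ρ) (hM : HasMoments t ρ) :
    IsDensityOperator ρ ∧ entropy ρ ≠ ⊤ ∧
      ∀ σ : FockSpace n →L[ℂ] FockSpace n,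
        IsDensityOperator σ → HasMoments t σ → SameMoments t σ ρ →
        entropy σ ≤ entropy ρ ∧ (entropy σ = entropy ρ → σ = ρ) := by
  obtain ⟨e, E, he, hs, hρ⟩ := hG
  set Z := ∑' j, Real.exp (-(β * E j)) with hZ
  set p : (Fin n → ℕ) → ℝ := fun k => Real.exp (-(β * E k)) / Z with hp_def
  have hZ0 : 0 < Z := hs.tsum_pos (fun _ => (Real.exp_pos _).le) 0 (Real.exp_pos _)
  have hp : ∀ k, 0 < p k := fun k => div_pos (Real.exp_pos _) hZ0
  have hp1 : HasSum p 1 := by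
    have := hs.hasSum.div_const Z
    rwa [← hZ, div_self hZ0.ne'] at this
  have hple : ∀ k, p k ≤ 1 := fun k => le_hasSum hp1 k fun j _ => (hp j).le
  -- The free energy. It lies below every `E k` because `p k ≤ 1`, so no lower bound on `H` has to
  -- be assumed.
  set E₀ : ℝ := -Real.log Z / β with hE₀
  have hlog : ∀ k, -Real.log (p k) = β * (E k - E₀) := fun k => by
    rw [hp_def, Real.log_div (Real.exp_pos _).ne' hZ0.ne', Real.log_exp, hE₀]
    field_simp
    ring
  have hE : ∀ k, E₀ ≤ E k := fun k => by
    have := Real.log_nonpos (hp k).le (hple k)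
    have h2 := hlog k
    exact sub_nonneg.1 (nonneg_of_mul_nonneg_right (by linarith) hβ)
  have hd : IsDensityOperator ρ := isDensityOperator_of_diagonal hρ (fun k => (hp k).le) hp1
  have hS : entropy ρ = ENNReal.ofReal β *
      ENNReal.ofReal ((c.sum fun w z => z * moment ρ w).re - E₀) := by
    rw [entropy_eq_tsum hd e,
      ← tsum_energy_eq_of_diagonal hH he hE (fun k => (hp k).le) hρ hd hM, ← ENNReal.tsum_mul_left]
    refine tsum_congr fun k => ?_
    rw [re_inner_negMulLogOp_of_apply_eq hd.isPositive hd.norm_le_one (hp k) (hple k)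
      (e.orthonormal.1 k) (hρ k), hlog, ← ENNReal.ofReal_mul hβ.le]
    ring_nf
  have hfin : entropy ρ ≠ ⊤ := hS ▸ ENNReal.mul_ne_top ENNReal.ofReal_ne_top ENNReal.ofReal_ne_top
  refine ⟨hd, hfin, fun σ hσ hMσ hsame => ?_⟩
  have hen : (c.sum fun w z => z * moment σ w) = c.sum fun w z => z * moment ρ w :=
    Finset.sum_congr rfl fun w hw =>
      congrArg (c w * ·) (hsame w (hH.degree_le w hw))
  have hent : entropy σ + ∑' k, ENNReal.ofReal (1 / 4 * ‖σ (e k) - (p k : ℂ) • e k‖ ^ 2) ≤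
      entropy ρ := by
    have h1 : ∑' k, ENNReal.ofReal (p k) = 1 := by
      rw [← ENNReal.ofReal_tsum_of_nonneg (fun k => (hp k).le) hp1.summable, hp1.tsum_eq,
        ENNReal.ofReal_one]
    have hnn := fun k => hσ.isPositive.re_inner_nonneg_right (e k)
    -- Klein's inequality carries `⟨e_k, σ e_k⟩` on the left and `p_k` on the right. Both sum to
    -- `1`, and adding this avoids subtraction in `[0, ∞]`.
    rw [← ENNReal.add_le_add_iff_right ENNReal.one_ne_top]
    calc entropy σ + ∑' k, ENNReal.ofReal (1 / 4 * ‖σ (e k) - (p k : ℂ) • e k‖ ^ 2) + 1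
        = ∑' k, ENNReal.ofReal (RCLike.re (inner ℂ (e k) (negMulLogOp σ (e k))) +
            1 / 4 * ‖σ (e k) - (p k : ℂ) • e k‖ ^ 2 + RCLike.re (inner ℂ (e k) (σ (e k)))) := by
          rw [entropy_eq_tsum hσ e, ← hσ.tsum_ofReal e, ← ENNReal.tsum_add, ← ENNReal.tsum_add]
          refine tsum_congr fun k => ?_
          have h2 := (isPositive_negMulLogOp hσ.isPositive
            hσ.norm_le_one).re_inner_nonneg_right (e k)
          have h3 : 0 ≤ 1 / 4 * ‖σ (e k) - (p k : ℂ) • e k‖ ^ 2 := by positivity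
          rw [ENNReal.ofReal_add (add_nonneg h2 h3) (hnn k), ENNReal.ofReal_add h2 h3]
      _ ≤ ∑' k, (ENNReal.ofReal β *
            ENNReal.ofReal ((E k - E₀) * RCLike.re (inner ℂ (e k) (σ (e k)))) +
            ENNReal.ofReal (p k)) := by
          refine ENNReal.tsum_le_tsum fun k => ?_
          rw [← ENNReal.ofReal_mul hβ.le, ← mul_assoc, ← hlog, ← ENNReal.ofReal_add
            (mul_nonneg (neg_nonneg.2 (Real.log_nonpos (hp k).le (hple k))) (hnn k)) (hp k).le]
          exact ENNReal.ofReal_le_ofReal (re_inner_negMulLogOp_add_le hσ.isPositive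
            hσ.norm_le_one (hp k) (hple k) (e.orthonormal.1 k))
      _ ≤ entropy ρ + 1 := by
          rw [ENNReal.tsum_add, ENNReal.tsum_mul_left, h1, hS, ← hen]
          gcongr
          exact tsum_energy_le hH he hE hσ hMσ
  refine ⟨le_self_add.trans hent, fun heq => ?_⟩
  rw [heq] at hent
  have h0 : ∑' k, ENNReal.ofReal (1 / 4 * ‖σ (e k) - (p k : ℂ) • e k‖ ^ 2) = 0 :=
    le_zero_iff.1 ((ENNReal.add_le_add_iff_left hfin).1 (hent.trans_eq (add_zero _).symm))
  have hk : ∀ k, σ (e k) = ρ (e k) := fun k => by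
    have h1 := ENNReal.ofReal_eq_zero.1 (ENNReal.tsum_eq_zero.1 h0 k)
    rw [hρ, ← sub_eq_zero, ← norm_eq_zero]
    exact pow_eq_zero_iff two_ne_zero |>.1 (le_antisymm (by linarith) (sq_nonneg _))
  ext1 x
  have h1 := (e.hasSum_repr x).mapL σ
  have h2 := (e.hasSum_repr x).mapL ρ
  exact h1.unique (h2.congr_fun fun k => by rw [map_smul, map_smul, hk])

end

section

variable {n t : ℕ} {c : List (Fin n ⊕ Fin n) →₀ ℂ} {H : FockSpace n →ₗ.[ℂ] FockSpace n}

lemma eq_pureState_of_sameMoments (hH : IsHamiltonian t c H) {E : ℝ} {ψ : FockSpace n}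
    (hψ : IsUniqueGroundState H E ψ) (hMψ : HasMoments t (pureState ψ))
    {σ : FockSpace n →L[ℂ] FockSpace n} (hσ : IsDensityOperator σ) (hM : HasMoments t σ)
    (hsame : SameMoments t σ (pureState ψ)) : σ = pureState ψ := by
  refine eq_pureState_of_energy_eq hH hψ hσ hM ?_
  have h : (c.sum fun w z => z * moment σ w) = c.sum fun w z => z * moment (pureState ψ) w :=
    Finset.sum_congr rfl fun w hw => congrArg (c w * ·) (hsame w (hH.degree_le w hw))
  rw [h, ← energy_eq_of_eigenvector hH hψ.norm_eq_one hψ.eigenvector hMψ, Complex.ofReal_re]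

end

end Bosonic

/-! ### Assembly of the three parts -/

theorem mainTheorem9 (n t : ℕ) :
    -- a `G_t` state is determined by its moments up to degree `t`
    (∀ ρ ρ' : Bosonic.FockSpace n →L[ℂ] Bosonic.FockSpace n,
      Bosonic.IsGt t ρ → Bosonic.IsGt t ρ' →
      Bosonic.HasMoments t ρ → Bosonic.HasMoments t ρ' →
      Bosonic.SameMoments t ρ ρ' → ρ = ρ') ∧
    -- mixed case: the unique state of maximal entropy among all states with its moments
    (∀ ρ : Bosonic.FockSpace n →L[ℂ] Bosonic.FockSpace n,
      Bosonic.IsMixedGt t ρ → Bosonic.HasMoments t ρ →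
      Bosonic.IsDensityOperator ρ ∧ Bosonic.entropy ρ ≠ ⊤ ∧
      ∀ σ : Bosonic.FockSpace n →L[ℂ] Bosonic.FockSpace n,
        Bosonic.IsDensityOperator σ → Bosonic.HasMoments t σ → Bosonic.SameMoments t σ ρ →
        Bosonic.entropy σ ≤ Bosonic.entropy ρ ∧
        (Bosonic.entropy σ = Bosonic.entropy ρ → σ = ρ)) ∧
    -- pure case
    (∀ (c : List (Fin n ⊕ Fin n) →₀ ℂ) (H : Bosonic.FockSpace n →ₗ.[ℂ] Bosonic.FockSpace n)
      (E : ℝ) (ψ : Bosonic.FockSpace n),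
      Bosonic.IsHamiltonian t c H → Bosonic.IsUniqueGroundState H E ψ →
      Bosonic.HasMoments t (Bosonic.pureState ψ) →
      -- the ground state energy is `∑ c_w M_w`, the minimum of `∑ c_w m_w` over the moments `m`
      -- of all states, and it is attained at the moments of `ψ` by the state `ψ` only
      (E : ℂ) = (c.sum fun w z => z * Bosonic.moment (Bosonic.pureState ψ) w) ∧
      (∀ σ : Bosonic.FockSpace n →L[ℂ] Bosonic.FockSpace n,
        Bosonic.IsDensityOperator σ → Bosonic.HasMoments t σ →
        E ≤ (c.sum fun w z => z * Bosonic.moment σ w).re ∧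
        ((c.sum fun w z => z * Bosonic.moment σ w).re = E → σ = Bosonic.pureState ψ)) ∧
      -- `ψ` is the only state, mixed or pure, with its moments up to degree `t`
      (∀ σ : Bosonic.FockSpace n →L[ℂ] Bosonic.FockSpace n,
        Bosonic.IsDensityOperator σ → Bosonic.HasMoments t σ →
        Bosonic.SameMoments t σ (Bosonic.pureState ψ) → σ = Bosonic.pureState ψ) ∧
      (∀ φ : Bosonic.FockSpace n, ‖φ‖ = 1 → Bosonic.HasMoments t (Bosonic.pureState φ) →
        Bosonic.SameMoments t (Bosonic.pureState φ) (Bosonic.pureState ψ) →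
        ∃ u : ℂ, ‖u‖ = 1 ∧ φ = u • ψ)) := by
  have mixed : ∀ ρ : Bosonic.FockSpace n →L[ℂ] Bosonic.FockSpace n,
      Bosonic.IsMixedGt t ρ → Bosonic.HasMoments t ρ →
      Bosonic.IsDensityOperator ρ ∧ Bosonic.entropy ρ ≠ ⊤ ∧
      ∀ σ : Bosonic.FockSpace n →L[ℂ] Bosonic.FockSpace n,
        Bosonic.IsDensityOperator σ → Bosonic.HasMoments t σ → Bosonic.SameMoments t σ ρ →
        Bosonic.entropy σ ≤ Bosonic.entropy ρ ∧
        (Bosonic.entropy σ = Bosonic.entropy ρ → σ = ρ) := by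
    rintro ρ ⟨c, H, β, hH, hβ, hG⟩ hM
    exact Bosonic.gibbs_maximizes_entropy hH hβ hG hM
  have pure : ∀ ρ : Bosonic.FockSpace n →L[ℂ] Bosonic.FockSpace n,
      Bosonic.IsPureGt t ρ → Bosonic.HasMoments t ρ →
      ∀ σ : Bosonic.FockSpace n →L[ℂ] Bosonic.FockSpace n,
        Bosonic.IsDensityOperator σ → Bosonic.HasMoments t σ → Bosonic.SameMoments t σ ρ →
        σ = ρ := by
    rintro ρ ⟨c, H, E, ψ, hH, hψ, rfl⟩ hM σ hσ hMσ hsame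
    exact Bosonic.eq_pureState_of_sameMoments hH hψ hM hσ hMσ hsame
  have density : ∀ ρ : Bosonic.FockSpace n →L[ℂ] Bosonic.FockSpace n,
      Bosonic.IsGt t ρ → Bosonic.HasMoments t ρ → Bosonic.IsDensityOperator ρ := by
    rintro ρ (hρ | ⟨c, H, E, ψ, hH, hψ, rfl⟩) hM
    · exact (mixed ρ hρ hM).1
    · exact Bosonic.isDensityOperator_pureState hψ.norm_eq_one
  refine ⟨fun ρ ρ' hρ hρ' hM hM' hsame => ?_, mixed, fun c H E ψ hH hψ hM => ⟨?_, ?_, ?_, ?_⟩⟩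
  · have hsame' : Bosonic.SameMoments t ρ' ρ := fun w hw => (hsame w hw).symm
    have hd := density ρ hρ hM
    have hd' := density ρ' hρ' hM'
    rcases hρ' with hρ' | hρ'
    · rcases hρ with hρ | hρ
      -- Each state maximizes entropy among states with the common moments, so the entropies agree
      -- and the equality case applies.
      · have h := (mixed ρ' hρ' hM').2.2 ρ hd hM hsame
        have h' := (mixed ρ hρ hM).2.2 ρ' hd' hM' hsame'
        exact h.2 (le_antisymm h.1 h'.1)
      · exact (pure ρ hρ hM ρ' hd' hM' hsame').symm
    · exact pure ρ' hρ' hM' ρ hd hM hsame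
  · exact Bosonic.energy_eq_of_eigenvector hH hψ.norm_eq_one hψ.eigenvector hM
  · exact fun σ hσ hMσ => ⟨Bosonic.le_energy hH hψ.energy_le hσ hMσ,
      Bosonic.eq_pureState_of_energy_eq hH hψ hσ hMσ⟩
  · exact fun σ hσ hMσ hsame => Bosonic.eq_pureState_of_sameMoments hH hψ hM hσ hMσ hsame
  · exact fun φ hφ hMφ hsame => Bosonic.exists_phase_of_pureState_eq hφ hψ.norm_eq_one
      (Bosonic.eq_pureState_of_sameMoments hH hψ hM (Bosonic.isDensityOperator_pureState hφ)
        hMφ hsame)
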